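/- Let $\pi:E\to M$ and $\pi':E'\to M'$ be smooth fibre bundles with $\dim M=\dim M'=n$, $\dim E=n+m$, $\dim E'=n+m'$. Let $J^\infty(\pi)=\varprojlim J^k(\pi)$ and $J^\infty(\pi')$ be the infinite jet spaces of their sections, with canonical coordinates $(x_i,u^j_\sigma)$ and $(x'_i,u'^j_\sigma)$ induced by local fibre coordinates ($\sigma$ a multi-index, $1_i$ the multi-index with $1$ in place $i$ and $0$ elsewhere), and total derivatives $$D_s=\partial_{x_s}+\sum_{j,\sigma}u^j_{\sigma+1_s}\,\partial_{u^j_\sigma}.$$ The Cartan plane $\mathcal C_\theta(\pi)$ is the common kernel at $\theta$ of the forms $\omega^j_\sigma=du^j_\sigma-\sum_i u^j_{\sigma+1_i}dx_i$. Let $U\subseteq J^\infty(\pi)$ be open (for instance $U=J^\infty(\pi)$). A $\mathcal C$-morphism $\mathcal B:U\to J^\infty(\pi')$ is a smooth map with $\mathcal B_*\mathcal C_\theta(\pi)\subseteq\mathcal C_{\mathcal B(\theta)}(\pi')$ for all $\theta\in U$; smooth means continuous and such that, for every $r$, the components of $\mathcal B$ of order at most $r$ are smooth functions of the coordinates of order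 at most $k$, for some finite $k$. In canonical coordinates write $\mathcal B$ as $x'_i=\xi^i$, $u'^j_\sigma=\nu^j_\sigma$, with $\nu^j_0=\nu^j$. It is regular if $\det(D_s\xi^i)\neq0$ at every point of $U$, in all canonical coordinates. Let $\mathcal B:U\to J^\infty(\pi')$ be a regular $\mathcal C$-morphism. Then: 1. In all canonical coordinates on $J^\infty(\pi)$ and $J^\infty(\pi')$, wherever $\mathcal B$ is expressed in them, and for every multi-index $\sigma$, the matrix prolongation formula $$\big(\nu^j_{\sigma+1_i}\big)_{i,j}=\big(D_s\xi^i\big)_{s,i}^{-1}\cdot\big(D_s\nu^j_\sigma\big)_{s,j}$$ holds (in each matrix the first index is the row index). 2. $\mathcal B$ is completely determined by its lower components $x'_i=\xi^i$, $u'^j=\nu^j$: if $\mathcal B_1:U\to J^\infty(\pi')$ is any $\mathcal C$-morphism with $\pi'_{\infty,0}\circ\mathcal B_1=\pi'_{\infty,0}\circ\mathcal B$ on $U$, where $\pi'_{\infty,0}:J^\infty(\pi')\to E'$ is the natural projection (that is, with the same lower components), then $\mathcal B_1=\mathcal B$ on $U$. -/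

import Mathlib

open scoped Manifold ContDiff Topology

noncomputable section

/-! ### Smooth fibre bundles and adapted coordinates -/

/-- `π : E → M` is a smooth fibre bundle with typical fibre `F`, where `dim M = n`, `dim F = m` and
`dim E = n + m`: near every point of `M` there is a smooth local trivialization. -/
def IsSmoothFiberBundle (n m : ℕ) {M E : Type*} (F : Type*)
    [TopologicalSpace M] [ChartedSpace (EuclideanSpace ℝ (Fin n)) M]
    [TopologicalSpace E] [ChartedSpace (EuclideanSpace ℝ (Fin (n + m))) E]
    [TopologicalSpace F] [ChartedSpace (EuclideanSpace ℝ (Fin m)) F]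
    (π : E → M) : Prop :=
  ∀ a : M, ∃ e : Bundle.Trivialization F π, a ∈ e.baseSet ∧
    ContMDiffOn (𝓡 (n + m)) ((𝓡 n).prod (𝓡 m)) ∞ e e.source ∧
    ContMDiffOn ((𝓡 n).prod (𝓡 m)) (𝓡 (n + m)) ∞ e.toOpenPartialHomeomorph.symm e.target

/-- A system of local fibre coordinates of `π`: smooth coordinates `(x, u)` on an open subset of `E`
such that `x` is the pull-back by `π` of smooth coordinates on an open subset of `M`. -/
structure FiberChart (n m : ℕ) {M E : Type*}
    [TopologicalSpace M] [ChartedSpace (EuclideanSpace ℝ (Fin n)) M]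
    [TopologicalSpace E] [ChartedSpace (EuclideanSpace ℝ (Fin (n + m))) E]
    (π : E → M) where
  /-- The coordinates `x` on `M`. -/
  base : OpenPartialHomeomorph M (EuclideanSpace ℝ (Fin n))
  /-- The coordinates `(x, u)` on `E`. -/
  total : OpenPartialHomeomorph E (EuclideanSpace ℝ (Fin n) × EuclideanSpace ℝ (Fin m))
  base_smooth : ContMDiffOn (𝓡 n) 𝓘(ℝ, EuclideanSpace ℝ (Fin n)) ∞ base base.source
  base_symm_smooth :
    ContMDiffOn 𝓘(ℝ, EuclideanSpace ℝ (Fin n)) (𝓡 n) ∞ base.symm base.target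
  total_smooth :
    ContMDiffOn (𝓡 (n + m)) 𝓘(ℝ, EuclideanSpace ℝ (Fin n) × EuclideanSpace ℝ (Fin m)) ∞
      total total.source
  total_symm_smooth :
    ContMDiffOn 𝓘(ℝ, EuclideanSpace ℝ (Fin n) × EuclideanSpace ℝ (Fin m)) (𝓡 (n + m)) ∞
      total.symm total.target
  proj_mem : ∀ p ∈ total.source, π p ∈ base.source
  fst_total : ∀ p ∈ total.source, (total p).1 = base (π p)

/-! ### Jets -/

/-- The partial derivative `∂f / ∂x_i`. -/
def partialDeriv {n : ℕ} (i : Fin n) (f : EuclideanSpace ℝ (Fin n) → ℝ) :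
    EuclideanSpace ℝ (Fin n) → ℝ :=
  fun x => fderiv ℝ f x (EuclideanSpace.single i 1)

/-- The iterated partial derivative `∂^|σ| f / ∂x_1^{σ_1} ⋯ ∂x_n^{σ_n}`. -/
def multiDeriv {n : ℕ} (σ : Fin n →₀ ℕ) (f : EuclideanSpace ℝ (Fin n) → ℝ) :
    EuclideanSpace ℝ (Fin n) → ℝ :=
  (List.finRange n).foldr (fun i g => (partialDeriv i)^[σ i] g) f

section Jets

variable (n m : ℕ) {M E : Type*}
  [TopologicalSpace M] [ChartedSpace (EuclideanSpace ℝ (Fin n)) M]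
  [TopologicalSpace E] [ChartedSpace (EuclideanSpace ℝ (Fin (n + m))) E]

/-- A point `a` of `M` with a smooth section of `π` defined near `a`
(the values of `sec` away from `a` are irrelevant). -/
structure PointedSection (π : E → M) where
  /-- The point `a`. -/
  pt : M
  /-- The local section. -/
  sec : M → E
  smooth : ∀ᶠ x in 𝓝 pt, ContMDiffAt (𝓡 n) (𝓡 (n + m)) ∞ sec x
  isSection : ∀ᶠ x in 𝓝 pt, π (sec x) = x

variable {n m} {π : E → M}

/-- The derivative `∂^|σ| s^j / ∂x^σ` at `a` of a local section `s`, in the fibre coordinates `c`. -/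
def FiberChart.sectionDeriv (c : FiberChart n m π) (r : PointedSection n m π)
    (j : Fin m) (σ : Fin n →₀ ℕ) : ℝ :=
  multiDeriv σ (fun x => (c.total (r.sec (c.base.symm x))).2 j) (c.base r.pt)

variable (n m) (π)

/-- Contact of order `k`: the two sections take the same value at the base point and there all
their derivatives of order at most `k` agree in fibre coordinates. -/
def contactSetoid (k : ℕ) : Setoid (PointedSection n m π) where
  r r₁ r₂ := r₁.sec r₁.pt = r₂.sec r₂.pt ∧
    ∀ c : FiberChart n m π, r₁.sec r₁.pt ∈ c.total.source →
      ∀ (j : Fin m) (σ : Fin n →₀ ℕ), σ.degree ≤ k →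
        c.sectionDeriv r₁ j σ = c.sectionDeriv r₂ j σ
  iseqv :=
    { refl := fun _ => ⟨rfl, fun _ _ _ _ _ => rfl⟩
      symm := fun h => ⟨h.1.symm, fun c hc j σ hσ => (h.2 c (h.1 ▸ hc) j σ hσ).symm⟩
      trans := fun h₁ h₂ => ⟨h₁.1.trans h₂.1, fun c hc j σ hσ =>
        (h₁.2 c hc j σ hσ).trans (h₂.2 c (h₁.1 ▸ hc) j σ hσ)⟩ }

/-- The jet space `J^k(π)`. -/
def JetSpace (k : ℕ) : Type _ := Quotient (contactSetoid n m π k)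

variable {n m} {π}

/-- The projection `J^k(π) → E`, `[s]_a^k ↦ s(a)`. -/
def JetSpace.toTotal {k : ℕ} (θ : JetSpace n m π k) : E :=
  Quotient.lift (s := contactSetoid n m π k) (fun r => r.sec r.pt) (fun _ _ h => h.1) θ

/-- The natural projection `π_{h,k} : J^h(π) → J^k(π)`, `[s]_a^h ↦ [s]_a^k`. -/
def JetSpace.proj {k h : ℕ} (hkh : k ≤ h) (θ : JetSpace n m π h) : JetSpace n m π k :=
  Quotient.map' (s₁ := contactSetoid n m π h) (s₂ := contactSetoid n m π k) id
    (fun _ _ hr => ⟨hr.1, fun c hc j σ hσ => hr.2 c hc j σ (hσ.trans hkh)⟩) θ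

open Classical in
/-- The canonical coordinate `u_σ^j` on `J^{|σ|}(π)` (given the value `0` at the jets that do not
lie over the domain of the fibre coordinates). -/
def FiberChart.jetCoord (c : FiberChart n m π) (j : Fin m) (σ : Fin n →₀ ℕ)
    (θ : JetSpace n m π σ.degree) : ℝ :=
  Quotient.lift (s := contactSetoid n m π σ.degree)
    (fun r => if r.sec r.pt ∈ c.total.source then c.sectionDeriv r j σ else 0)
    (fun r₁ r₂ h => by
      by_cases hc : r₁.sec r₁.pt ∈ c.total.source
      · have hc' : r₂.sec r₂.pt ∈ c.total.source := h.1 ▸ hc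
        simp only [hc, hc', if_true]
        exact h.2 c hc j σ le_rfl
      · have hc' : r₂.sec r₂.pt ∉ c.total.source := h.1 ▸ hc
        simp only [hc, hc', if_false]) θ

variable (n m) (π)

/-- The infinite jet space `J^∞(π)`, the inverse limit of the `J^k(π)`. -/
def InfJet : Type _ :=
  {θ : ∀ k, JetSpace n m π k // ∀ (k h : ℕ) (hkh : k ≤ h), (θ h).proj hkh = θ k}

variable {n m} {π}

/-- The projection `π_{∞,0} : J^∞(π) → E`. -/
def InfJet.toTotal (θ : InfJet n m π) : E := (θ.1 0).toTotal

variable (n m)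

/-- The space of the values of the canonical coordinates `(x_i, u_σ^j)` of `J^∞(π)`, with the
product topology. -/
abbrev JetCoords : Type := (Fin n → ℝ) × (Fin m → (Fin n →₀ ℕ) → ℝ)

variable {n m}

/-- The part of `J^∞(π)` on which the canonical coordinates induced by `c` are defined. -/
def FiberChart.jetDomain (c : FiberChart n m π) : Set (InfJet n m π) :=
  {θ | θ.toTotal ∈ c.total.source}

/-- The canonical coordinates `(x_i, u_σ^j)` on `J^∞(π)` induced by `c`. -/
def FiberChart.coords (c : FiberChart n m π) (θ : InfJet n m π) : JetCoords n m :=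
  (fun i => c.base (π θ.toTotal) i, fun j σ => c.jetCoord j σ (θ.1 σ.degree))

/-- The expression in canonical coordinates of a function given on a set `W` of jets
(`W` lies in the domain of the coordinates). -/
def FiberChart.localExpr (c : FiberChart n m π) (W : Set (InfJet n m π))
    (f : InfJet n m π → ℝ) : JetCoords n m → ℝ :=
  Function.extend (fun θ : W => c.coords θ) (fun θ : W => f θ) 0

end Jets

/-! ### Calculus in canonical coordinates -/

instance finiteMultiIndexLE (n k : ℕ) : Finite {σ : Fin n →₀ ℕ // σ.degree ≤ k} :=
  (Finsupp.finite_of_degree_le k).to_subtype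

instance fintypeMultiIndexLE (n k : ℕ) : Fintype {σ : Fin n →₀ ℕ // σ.degree ≤ k} :=
  Fintype.ofFinite _

/-- The coordinates of order at most `k`. -/
def truncCoords {n m : ℕ} (k : ℕ) (p : JetCoords n m) :
    (Fin n → ℝ) × (Fin m → {σ : Fin n →₀ ℕ // σ.degree ≤ k} → ℝ) :=
  (p.1, fun j σ => p.2 j σ)

/-- `f` is on `S` a smooth function `f(x, u^{(k)})` of the coordinates of order at most `k`. -/
def IsSmoothOfOrder {n m : ℕ} (k : ℕ) (S : Set (JetCoords n m)) (f : JetCoords n m → ℝ) : Prop :=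
  ∀ p ∈ S, ∃ g : (Fin n → ℝ) × (Fin m → {σ : Fin n →₀ ℕ // σ.degree ≤ k} → ℝ) → ℝ,
    ContDiff ℝ ∞ g ∧ ∀ᶠ q in 𝓝 p, f q = g (truncCoords k q)

/-- The Cartan plane at `p`: the vectors `X = (ẋ, u̇)` annihilated by all the Cartan forms
`ω_σ^j = du_σ^j - ∑_i u_{σ+1_i}^j dx_i`. -/
def cartanPlane {n m : ℕ} (p : JetCoords n m) : Set (JetCoords n m) :=
  {X | ∀ (j : Fin m) (σ : Fin n →₀ ℕ),
    X.2 j σ - ∑ i, p.2 j (σ + Finsupp.single i 1) * X.1 i = 0}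

/-- The total derivative `D_s = ∂_{x_s} + ∑_{j,σ} u_{σ+1_s}^j ∂_{u_σ^j}` as a vector at `p`. -/
def totalVector {n m : ℕ} (s : Fin n) (p : JetCoords n m) : JetCoords n m :=
  (Pi.single s 1, fun j σ => p.2 j (σ + Finsupp.single s 1))

/-- `D_s f`, the derivative of `f` along the total derivative vector field `D_s`. -/
def totalDeriv {n m : ℕ} (s : Fin n) (f : JetCoords n m → ℝ) (p : JetCoords n m) : ℝ :=
  lineDeriv ℝ f p (totalVector s p)

/-! ### `C`-morphisms -/

section Morphisms

variable {n m m' : ℕ} {M E M' E' : Type*}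
  [TopologicalSpace M] [ChartedSpace (EuclideanSpace ℝ (Fin n)) M]
  [TopologicalSpace E] [ChartedSpace (EuclideanSpace ℝ (Fin (n + m))) E]
  [TopologicalSpace M'] [ChartedSpace (EuclideanSpace ℝ (Fin n)) M']
  [TopologicalSpace E'] [ChartedSpace (EuclideanSpace ℝ (Fin (n + m'))) E']
  {π : E → M} {π' : E' → M'}

/-- The jets in `U` at which `B` is expressed in the canonical coordinates induced by `c`, `c'`. -/
def overlap (U : Set (InfJet n m π)) (B : InfJet n m π → InfJet n m' π')
    (c : FiberChart n m π) (c' : FiberChart n m' π') : Set (InfJet n m π) :=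
  {θ | θ ∈ U ∧ θ ∈ c.jetDomain ∧ B θ ∈ c'.jetDomain}

/-- The component `x'_i = ξ^i` of `B : U → J^∞(π')` in canonical coordinates. -/
def xiComp (U : Set (InfJet n m π)) (B : InfJet n m π → InfJet n m' π')
    (c : FiberChart n m π) (c' : FiberChart n m' π') (i : Fin n) : JetCoords n m → ℝ :=
  c.localExpr (overlap U B c c') (fun θ => (c'.coords (B θ)).1 i)

/-- The component `u'_σ^j = ν_σ^j` of `B : U → J^∞(π')` in canonical coordinates. -/
def nuComp (U : Set (InfJet n m π)) (B : InfJet n m π → InfJet n m' π')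
    (c : FiberChart n m π) (c' : FiberChart n m' π') (j : Fin m') (σ : Fin n →₀ ℕ) :
    JetCoords n m → ℝ :=
  c.localExpr (overlap U B c c') (fun θ => (c'.coords (B θ)).2 j σ)

/-- `U` is open, for the inverse limit topology of `J^∞(π)`. -/
def IsOpenInJets (U : Set (InfJet n m π)) : Prop :=
  ∀ c : FiberChart n m π, IsOpen (c.coords '' (U ∩ c.jetDomain))

/-- `B : U → J^∞(π')` is smooth: it is continuous, and for every `r` its components of order at
most `r` are smooth functions of some finite order `k`. -/
structure IsSmoothJetMap (U : Set (InfJet n m π)) (B : InfJet n m π → InfJet n m' π') :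
    Prop where
  isOpen_overlap : ∀ (c : FiberChart n m π) (c' : FiberChart n m' π'),
    IsOpen (c.coords '' overlap U B c c')
  smooth : ∀ r : ℕ, ∃ k : ℕ, ∀ (c : FiberChart n m π) (c' : FiberChart n m' π'),
    (∀ i, IsSmoothOfOrder k (c.coords '' overlap U B c c') (xiComp U B c c' i)) ∧
    ∀ (j : Fin m') (σ : Fin n →₀ ℕ), σ.degree ≤ r →
      IsSmoothOfOrder k (c.coords '' overlap U B c c') (nuComp U B c c' j σ)

/-- The push-forward `B_* X`, in canonical coordinates, of a vector `X` at the jet with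
coordinates `p`. -/
def pushforwardVector (U : Set (InfJet n m π)) (B : InfJet n m π → InfJet n m' π')
    (c : FiberChart n m π) (c' : FiberChart n m' π') (p X : JetCoords n m) : JetCoords n m' :=
  (fun i => lineDeriv ℝ (xiComp U B c c' i) p X,
    fun j σ => lineDeriv ℝ (nuComp U B c c' j σ) p X)

/-- `B : U → J^∞(π')` is a `C`-morphism: a smooth map with `B_* C_θ(π) ⊆ C_{B(θ)}(π')`
for all `θ ∈ U`. -/
structure IsCMorphism (U : Set (InfJet n m π)) (B : InfJet n m π → InfJet n m' π') : Prop
    extends IsSmoothJetMap U B where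
  map_cartan : ∀ (c : FiberChart n m π) (c' : FiberChart n m' π'), ∀ θ ∈ overlap U B c c',
    ∀ X ∈ cartanPlane (c.coords θ),
      pushforwardVector U B c c' (c.coords θ) X ∈ cartanPlane (c'.coords (B θ))

/-- The matrix `(D_s ξ^i)`, with row index `s` and column index `i`, at the jet `θ`. -/
def totalJacobian (U : Set (InfJet n m π)) (B : InfJet n m π → InfJet n m' π')
    (c : FiberChart n m π) (c' : FiberChart n m' π') (θ : InfJet n m π) :
    Matrix (Fin n) (Fin n) ℝ :=
  Matrix.of fun s i => totalDeriv s (xiComp U B c c' i) (c.coords θ)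

/-- A regular `C`-morphism: a `C`-morphism with `det (D_s ξ^i) ≠ 0`. -/
structure IsRegularCMorphism (U : Set (InfJet n m π)) (B : InfJet n m π → InfJet n m' π') : Prop
    extends IsCMorphism U B where
  regular : ∀ (c : FiberChart n m π) (c' : FiberChart n m' π'), ∀ θ ∈ overlap U B c c',
    (totalJacobian U B c c' θ).det ≠ 0

end Morphisms

end

/-! The total derivative `D_s` lies in the Cartan plane, so its push-forward by `B` is annihilated
by every form `ω'_σ^j` at `B θ`. Written out, this is `D_s ν_σ^j = ∑_i D_s ξ^i · ν_{σ+1_i}^j`, a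
matrix identity (`IsCMorphism.totalJacobian_mul`); inverting the Jacobian gives the prolongation
formula. For uniqueness, the Jacobian involves only the `ξ^i`, so a second `C`-morphism with the
same lower components satisfies the same recursion. Induction on `|σ|` identifies all components
(`IsRegularCMorphism.coords_eq`), and coordinates separate infinite jets (`InfJet.ext_coords`). -/

section FiberCharts

/-! ### Existence of fibre coordinates. -/

variable {n m : ℕ} {M E F : Type*}
  [TopologicalSpace M] [ChartedSpace (EuclideanSpace ℝ (Fin n)) M]
  [TopologicalSpace E] [ChartedSpace (EuclideanSpace ℝ (Fin (n + m))) E]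
  [TopologicalSpace F] [ChartedSpace (EuclideanSpace ℝ (Fin m)) F]
  {π : E → M}

/-- A smooth local trivialization, composed with charts of the base and of the fibre, is a system of
fibre coordinates. -/
def FiberChart.ofTrivialization [IsManifold (𝓡 n) ∞ M] [IsManifold (𝓡 m) ∞ F]
    (e : Bundle.Trivialization F π)
    (he : ContMDiffOn (𝓡 (n + m)) ((𝓡 n).prod (𝓡 m)) ∞ e e.source)
    (he' : ContMDiffOn ((𝓡 n).prod (𝓡 m)) (𝓡 (n + m)) ∞ e.toOpenPartialHomeomorph.symm e.target)
    (a : M) (y : F) : FiberChart n m π where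
  base := chartAt (EuclideanSpace ℝ (Fin n)) a
  total := e.toOpenPartialHomeomorph.trans
    ((chartAt (EuclideanSpace ℝ (Fin n)) a).prod (chartAt (EuclideanSpace ℝ (Fin m)) y))
  base_smooth := contMDiffOn_chart
  base_symm_smooth := contMDiffOn_chart_symm
  total_smooth := by
    have h₁ : ContMDiffOn (𝓡 n) (𝓡 n) ∞ (chartAt (EuclideanSpace ℝ (Fin n)) a)
      (chartAt (EuclideanSpace ℝ (Fin n)) a).source := contMDiffOn_chart
    have h₂ : ContMDiffOn (𝓡 m) (𝓡 m) ∞ (chartAt (EuclideanSpace ℝ (Fin m)) y)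
      (chartAt (EuclideanSpace ℝ (Fin m)) y).source := contMDiffOn_chart
    have hs := he.mono (fun p (hp : p ∈ (e.toOpenPartialHomeomorph.trans
      ((chartAt (EuclideanSpace ℝ (Fin n)) a).prod
        (chartAt (EuclideanSpace ℝ (Fin m)) y))).source) => hp.1)
    exact (h₁.comp (contMDiff_fst.comp_contMDiffOn hs) fun p hp => hp.2.1).prodMk_space
      (h₂.comp (contMDiff_snd.comp_contMDiffOn hs) fun p hp => hp.2.2)
  total_symm_smooth := by
    have h₁ : ContMDiffOn (𝓡 n) (𝓡 n) ∞ (chartAt (EuclideanSpace ℝ (Fin n)) a).symm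
      (chartAt (EuclideanSpace ℝ (Fin n)) a).target := contMDiffOn_chart_symm
    have h₂ : ContMDiffOn (𝓡 m) (𝓡 m) ∞ (chartAt (EuclideanSpace ℝ (Fin m)) y).symm
      (chartAt (EuclideanSpace ℝ (Fin m)) y).target := contMDiffOn_chart_symm
    exact he'.comp
      ((h₁.comp contDiff_fst.contMDiff.contMDiffOn fun q hq => hq.1.1).prodMk
        (h₂.comp contDiff_snd.contMDiff.contMDiffOn fun q hq => hq.1.2)) fun q hq => hq.2
  proj_mem := fun p hp => by
    have h : (e p).1 ∈ (chartAt (EuclideanSpace ℝ (Fin n)) a).source := hp.2.1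
    rwa [e.coe_fst hp.1] at h
  fst_total := fun p hp => by
    change chartAt (EuclideanSpace ℝ (Fin n)) a (e p).1 = _
    rw [e.coe_fst hp.1]

theorem IsSmoothFiberBundle.exists_fiberChart [IsManifold (𝓡 n) ∞ M] [IsManifold (𝓡 m) ∞ F]
    (hπ : IsSmoothFiberBundle n m F π) (p : E) :
    ∃ c : FiberChart n m π, p ∈ c.total.source := by
  obtain ⟨e, hpe, he, he'⟩ := hπ (π p)
  refine ⟨FiberChart.ofTrivialization e he he' (π p) (e p).2, e.mem_source.2 hpe, ?_, ?_⟩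
  · change (e p).1 ∈ (chartAt (EuclideanSpace ℝ (Fin n)) (π p)).source
    rw [e.coe_fst' hpe]
    exact mem_chart_source _ _
  · exact mem_chart_source (EuclideanSpace ℝ (Fin m)) (e p).2

end FiberCharts

/-! ### Coordinates on infinite jets and their separation property. -/

section JetCoordinates

variable {n m : ℕ} {M E : Type*}
  [TopologicalSpace M] [ChartedSpace (EuclideanSpace ℝ (Fin n)) M]
  [TopologicalSpace E] [ChartedSpace (EuclideanSpace ℝ (Fin (n + m))) E]
  {π : E → M}

theorem JetSpace.toTotal_proj {k h : ℕ} (hkh : k ≤ h) (θ : JetSpace n m π h) :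
    (θ.proj hkh).toTotal = θ.toTotal := by
  induction θ using Quotient.ind
  rfl

theorem InfJet.toTotal_apply (θ : InfJet n m π) (k : ℕ) : (θ.1 k).toTotal = θ.toTotal := by
  rw [InfJet.toTotal, ← θ.2 0 k (Nat.zero_le k), JetSpace.toTotal_proj]

theorem FiberChart.jetCoord_proj_mk (c : FiberChart n m π) (r : PointedSection n m π)
    (hr : r.sec r.pt ∈ c.total.source) (j : Fin m) (σ : Fin n →₀ ℕ) {k : ℕ} (hσ : σ.degree ≤ k) :
    c.jetCoord j σ (JetSpace.proj hσ (Quotient.mk (contactSetoid n m π k) r)) =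
      c.sectionDeriv r j σ :=
  if_pos hr

/-- Infinite jets are separated by their projections to `E` and their canonical coordinates. -/
theorem InfJet.ext_coords {θ₁ θ₂ : InfJet n m π} (h : θ₁.toTotal = θ₂.toTotal)
    (hc : ∀ c : FiberChart n m π, θ₁ ∈ c.jetDomain → ∀ j σ,
      (c.coords θ₁).2 j σ = (c.coords θ₂).2 j σ) : θ₁ = θ₂ := by
  refine Subtype.ext (funext fun k => ?_)
  obtain ⟨r₁, hr₁⟩ := Quotient.exists_rep (θ₁.1 k)
  obtain ⟨r₂, hr₂⟩ := Quotient.exists_rep (θ₂.1 k)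
  have h₁ : r₁.sec r₁.pt = θ₁.toTotal := by rw [← θ₁.toTotal_apply k, ← hr₁]; rfl
  have h₂ : r₂.sec r₂.pt = θ₂.toTotal := by rw [← θ₂.toTotal_apply k, ← hr₂]; rfl
  rw [← hr₁, ← hr₂]
  refine Quotient.sound ⟨by rw [h₁, h₂, h], fun c hcr j σ hσ => ?_⟩
  have hd : θ₁ ∈ c.jetDomain := by rw [h₁] at hcr; exact hcr
  have key : c.jetCoord j σ (θ₁.1 σ.degree) = c.jetCoord j σ (θ₂.1 σ.degree) := hc c hd j σ
  -- `u_σ^j` lives on `J^{|σ|}`; compatibility of the inverse system rewrites it through level `k`,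
  -- where `r₁` and `r₂` are representatives.
  rwa [← θ₁.2 _ k hσ, ← θ₂.2 _ k hσ, ← hr₁, ← hr₂, c.jetCoord_proj_mk r₁ hcr,
    c.jetCoord_proj_mk r₂ (by rw [h₂, ← h, ← h₁]; exact hcr)] at key

theorem multiDeriv_zero (f : EuclideanSpace ℝ (Fin n) → ℝ) : multiDeriv 0 f = f := by
  unfold multiDeriv
  induction List.finRange n with
  | nil => rfl
  | cons i l ih => simp

/-- The coordinates `u_0^j` are the fibre coordinates on `E`. -/
theorem FiberChart.coords_snd_zero (c : FiberChart n m π) {θ : InfJet n m π}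
    (hθ : θ ∈ c.jetDomain) (j : Fin m) : (c.coords θ).2 j 0 = (c.total θ.toTotal).2 j := by
  -- Projecting along this inequality avoids rewriting the index `Finsupp.degree 0` inside a
  -- dependent type.
  have hk : (0 : Fin n →₀ ℕ).degree ≤ 0 := (map_zero Finsupp.degree).le
  change c.jetCoord j 0 (θ.1 (Finsupp.degree 0)) = _
  obtain ⟨r, hr⟩ := Quotient.exists_rep (θ.1 0)
  have h : r.sec r.pt = θ.toTotal := by rw [← θ.toTotal_apply 0, ← hr]; rfl
  have hs : r.sec r.pt ∈ c.total.source := by rw [h]; exact hθ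
  have hpt : r.pt ∈ c.base.source := by
    have := c.proj_mem _ hs
    rwa [r.isSection.self_of_nhds] at this
  rw [← θ.2 _ 0 hk, ← hr, c.jetCoord_proj_mk r hs, FiberChart.sectionDeriv, multiDeriv_zero,
    c.base.left_inv hpt, h]

theorem totalVector_mem_cartanPlane (s : Fin n) (p : JetCoords n m) :
    totalVector s p ∈ cartanPlane p := by
  intro j σ
  simp [totalVector, Pi.single_apply]

end JetCoordinates

/-! ### The prolongation formula and uniqueness. -/

section Prolongation

variable {n m m' : ℕ} {M E M' E' : Type*}
  [TopologicalSpace M] [ChartedSpace (EuclideanSpace ℝ (Fin n)) M]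
  [TopologicalSpace E] [ChartedSpace (EuclideanSpace ℝ (Fin (n + m))) E]
  [TopologicalSpace M'] [ChartedSpace (EuclideanSpace ℝ (Fin n)) M']
  [TopologicalSpace E'] [ChartedSpace (EuclideanSpace ℝ (Fin (n + m'))) E']
  {π : E → M} {π' : E' → M'} {U : Set (InfJet n m π)} {B B₁ : InfJet n m π → InfJet n m' π'}
  {c : FiberChart n m π} {c' : FiberChart n m' π'} {θ : InfJet n m π}

/-- Entry `(s, j)` is the vanishing of `ω'_σ^j` on the push-forward of `D_s`, whose components are
by definition the total derivatives of `ξ^i` and `ν_σ^j`. -/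
theorem IsCMorphism.totalJacobian_mul (hB : IsCMorphism U B) (hθ : θ ∈ overlap U B c c')
    (σ : Fin n →₀ ℕ) :
    (totalJacobian U B c c' θ *
        Matrix.of fun (i : Fin n) (j : Fin m') =>
          (c'.coords (B θ)).2 j (σ + Finsupp.single i 1)) =
      Matrix.of fun (s : Fin n) (j : Fin m') =>
        totalDeriv s (nuComp U B c c' j σ) (c.coords θ) := by
  ext s j
  have h := hB.map_cartan c c' θ hθ _ (totalVector_mem_cartanPlane s (c.coords θ)) j σ
  rw [sub_eq_zero] at h
  refine Eq.trans ?_ h.symm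
  rw [Matrix.mul_apply]
  exact Finset.sum_congr rfl fun i _ => mul_comm _ _

/-- The matrix prolongation formula. -/
theorem IsCMorphism.prolongation (hB : IsCMorphism U B) (hθ : θ ∈ overlap U B c c')
    (hdet : (totalJacobian U B c c' θ).det ≠ 0) (σ : Fin n →₀ ℕ) :
    (Matrix.of fun (i : Fin n) (j : Fin m') =>
        (c'.coords (B θ)).2 j (σ + Finsupp.single i 1)) =
      (totalJacobian U B c c' θ)⁻¹ *
        Matrix.of fun (s : Fin n) (j : Fin m') =>
          totalDeriv s (nuComp U B c c' j σ) (c.coords θ) := by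
  rw [← hB.totalJacobian_mul hθ, Matrix.nonsing_inv_mul_cancel_left _ _ hdet.isUnit]

theorem FiberChart.localExpr_congr {W : Set (InfJet n m π)} {f g : InfJet n m π → ℝ}
    (h : ∀ θ ∈ W, f θ = g θ) : c.localExpr W f = c.localExpr W g := by
  unfold FiberChart.localExpr
  congr 1
  exact funext fun θ => h θ.1 θ.2

/-- Whether `B θ` lies over the domain of `c'` is decided by its projection to `E'`. -/
theorem overlap_congr (h : ∀ θ ∈ U, (B₁ θ).toTotal = (B θ).toTotal) :
    overlap U B₁ c c' = overlap U B c c' := by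
  ext θ
  refine and_congr_right fun hθ => and_congr_right fun _ => ?_
  simp only [FiberChart.jetDomain, Set.mem_ofPred_eq, h θ hθ]

/-- This transfers regularity from `B` to `B₁`, which is only assumed to be a `C`-morphism. -/
theorem totalJacobian_congr (h : ∀ θ ∈ U, (B₁ θ).toTotal = (B θ).toTotal) :
    totalJacobian U B₁ c c' θ = totalJacobian U B c c' θ := by
  have hξ : ∀ i, xiComp U B₁ c c' i = xiComp U B c c' i := fun i => by
    unfold xiComp
    rw [overlap_congr h]
    refine FiberChart.localExpr_congr fun θ hθ => ?_
    simp only [FiberChart.coords, h θ hθ.1]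
  simp only [totalJacobian, hξ]

/-- The lower components of a regular `C`-morphism determine all its components. -/
theorem IsRegularCMorphism.coords_eq (hB : IsRegularCMorphism U B) (hB₁ : IsCMorphism U B₁)
    (h : ∀ θ ∈ U, (B₁ θ).toTotal = (B θ).toTotal) (j : Fin m') (σ : Fin n →₀ ℕ) :
    ∀ θ ∈ overlap U B c c', (c'.coords (B₁ θ)).2 j σ = (c'.coords (B θ)).2 j σ := by
  -- The claim is proved on the whole overlap at once: the inductive step differentiates `ν_τ`, so
  -- equality at a single jet would not suffice.
  induction hd : σ.degree generalizing σ j with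
  | zero =>
    intro θ hθ
    rw [(Finsupp.degree_eq_zero_iff σ).1 hd, c'.coords_snd_zero hθ.2.2,
      c'.coords_snd_zero ((overlap_congr h).superset hθ).2.2, h θ hθ.1]
  | succ d ih =>
    intro θ hθ
    obtain ⟨i, hi⟩ : ∃ i, σ i ≠ 0 := by
      by_contra! h0
      rw [show σ = 0 from Finsupp.ext h0, map_zero] at hd
      omega
    obtain ⟨τ, rfl⟩ : ∃ τ, σ = τ + Finsupp.single i 1 :=
      ⟨σ - Finsupp.single i 1, (tsub_add_cancel_of_le
        (Finsupp.single_le_iff.2 (Nat.one_le_iff_ne_zero.2 hi))).symm⟩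
    have hτ : τ.degree = d := by
      rw [map_add, Finsupp.degree_single] at hd
      omega
    have hν : ∀ j, nuComp U B₁ c c' j τ = nuComp U B c c' j τ := fun j => by
      unfold nuComp
      rw [overlap_congr h]
      exact FiberChart.localExpr_congr (ih j τ hτ)
    have hdet := hB.regular c c' θ hθ
    have e := hB.toIsCMorphism.prolongation hθ hdet τ
    have e₁ := hB₁.prolongation (overlap_congr h ▸ hθ) (totalJacobian_congr h ▸ hdet) τ
    simp only [totalJacobian_congr h, hν] at e₁
    -- Both formulas now have the same right-hand side; row `i` is the coordinate of index `τ + 1_i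
    -- = σ`.
    exact congrFun (congrFun (e₁.trans e.symm) i) j

end Prolongation

theorem mainTheorem6 (n m m' : ℕ) {M E F M' E' F' : Type*}
    [TopologicalSpace M] [ChartedSpace (EuclideanSpace ℝ (Fin n)) M] [IsManifold (𝓡 n) ∞ M]
    [TopologicalSpace E] [ChartedSpace (EuclideanSpace ℝ (Fin (n + m))) E]
    [IsManifold (𝓡 (n + m)) ∞ E]
    [TopologicalSpace F] [ChartedSpace (EuclideanSpace ℝ (Fin m)) F] [IsManifold (𝓡 m) ∞ F]
    [TopologicalSpace M'] [ChartedSpace (EuclideanSpace ℝ (Fin n)) M'] [IsManifold (𝓡 n) ∞ M']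
    [TopologicalSpace E'] [ChartedSpace (EuclideanSpace ℝ (Fin (n + m'))) E']
    [IsManifold (𝓡 (n + m')) ∞ E']
    [TopologicalSpace F'] [ChartedSpace (EuclideanSpace ℝ (Fin m')) F'] [IsManifold (𝓡 m') ∞ F']
    (π : E → M) (hπ : IsSmoothFiberBundle n m F π)
    (π' : E' → M') (hπ' : IsSmoothFiberBundle n m' F' π')
    (U : Set (InfJet n m π)) (hU : IsOpenInJets U)
    (B : InfJet n m π → InfJet n m' π') (hB : IsRegularCMorphism U B) :
    (∀ (c : FiberChart n m π) (c' : FiberChart n m' π'), ∀ θ ∈ overlap U B c c',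
      ∀ σ : Fin n →₀ ℕ,
        (Matrix.of fun (i : Fin n) (j : Fin m') =>
            (c'.coords (B θ)).2 j (σ + Finsupp.single i 1)) =
          (totalJacobian U B c c' θ)⁻¹ *
            Matrix.of fun (s : Fin n) (j : Fin m') =>
              totalDeriv s (nuComp U B c c' j σ) (c.coords θ)) ∧
    (∀ B₁ : InfJet n m π → InfJet n m' π', IsCMorphism U B₁ →
      (∀ θ ∈ U, (B₁ θ).toTotal = (B θ).toTotal) → ∀ θ ∈ U, B₁ θ = B θ) := by
  refine ⟨fun c c' θ hθ σ => hB.toIsCMorphism.prolongation hθ (hB.regular c c' θ hθ) σ,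
    fun B₁ hB₁ h θ hθ => InfJet.ext_coords (h θ hθ) fun c' hc' j σ => ?_⟩
  -- The target chart `c'` is supplied by the separation lemma; only a chart around the source jet
  -- has to be found.
  obtain ⟨c, hc⟩ := hπ.exists_fiberChart θ.toTotal
  exact hB.coords_eq hB₁ h j σ θ ((overlap_congr h).subset ⟨hθ, hc, hc'⟩)
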